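/- A *weight* is a continuous non-increasing function $v:[0,\infty)\to(0,\infty)$ with $\lim_{r\to\infty} r^m v(r)=0$ for every $m\in\mathbb N$; put $v(z):=v(|z|)$ for $z\in\mathbb C$. For a weight $v$ let $$H_v^\infty:=\{f \text{ entire} : \|f\|_v:=\sup_{z\in\mathbb C} v(z)|f(z)|<\infty\},\qquad H_v^0:=\{f \text{ entire} : \lim_{|z|\to\infty} v(z)|f(z)|=0\},$$ both with the norm $\|\cdot\|_v$, and let $\tilde v(z):=\big(\sup\{|f(z)| : f\in H_v^\infty,\ \|f\|_v\le 1\}\big)^{-1}$ be the associated weight. For an entire function $h$ write $M_h f:=hf$; a statement "$M_h:X\to Y$ is (weakly) compact" includes that $M_h$ maps $X$ into $Y$. A sequence $(z_j)_{j\in\mathbb N}$ in $\mathbb C$ is *interpolating for* $H_{\tilde v}^\infty:=\{f\text{ entire}:\sup_z \tilde v(z)|f(z)|<\infty\}$ if for every complex sequence $(\alpha_j)_j$ with $\sup_j \tilde v(z_j)|\alpha_j|<\infty$ there is $f\in H_{\tilde v}^\infty$ with $f(z_j)=\alpha_j$ for all $j$. A sequence of distinct points of $\mathbb C$ is *discrete*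 if it has no accumulation point in $\mathbb C$, i.e. $|z_j|\to\infty$. **Proposition.** Let $v$ and $w$ be weights and let $h$ be an entire function. The following conditions are equivalent: 1. $M_h:H_v^\infty\to H_w^\infty$ is compact. 2. $M_h:H_v^0\to H_w^0$ is compact. 3. $\displaystyle\lim_{|z|\to\infty}\frac{w(z)|h(z)|}{\tilde v(z)}=0$. 4. $\displaystyle\lim_{|z|\to\infty}\frac{\tilde w(z)|h(z)|}{\tilde v(z)}=0$. If, moreover, every discrete sequence in $\mathbb C$ has a subsequence that is interpolating for $H_{\tilde v}^\infty$, these four conditions are also equivalent to each of the following: 5. $M_h:H_v^\infty\to H_w^\infty$ is weakly compact. 6. $M_h:H_v^0\to H_w^0$ is weakly compact. -/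

import Mathlib

open Filter Topology
open scoped NNReal

noncomputable section

namespace WeightedEntire

/-- A weight: a continuous, strictly positive, non-increasing function on `[0, ∞)` which decays
faster than every power. -/
structure Weight where
  toFun : ℝ≥0 → ℝ
  continuous_toFun : Continuous toFun
  pos : ∀ r, 0 < toFun r
  antitone : Antitone toFun
  decay : ∀ m : ℕ, Tendsto (fun r : ℝ≥0 => (r : ℝ) ^ m * toFun r) atTop (𝓝 0)

/-- The radial extension `v(z) := v(|z|)` of a weight to the complex plane. -/
def Weight.radial (v : Weight) (z : ℂ) : ℝ := v.toFun ‖z‖₊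

instance : CoeFun Weight (fun _ => ℂ → ℝ) := ⟨Weight.radial⟩

theorem Weight.radial_pos (v : Weight) (z : ℂ) : 0 < v z := v.pos _

theorem Weight.continuous_radial (v : Weight) : Continuous v.radial :=
  v.continuous_toFun.comp continuous_nnnorm

/-- `f` is entire and `u |f|` is bounded on the plane. -/
def MemHInf (u : ℂ → ℝ) (f : ℂ → ℂ) : Prop :=
  Differentiable ℂ f ∧ BddAbove (Set.range fun z => u z * ‖f z‖)

/-- `f` is entire and `u(z) |f(z)| → 0` as `|z| → ∞`. -/
def MemHZero (u : ℂ → ℝ) (f : ℂ → ℂ) : Prop :=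
  Differentiable ℂ f ∧ Tendsto (fun z => u z * ‖f z‖) (cocompact ℂ) (𝓝 0)

/-- For a weight `v`, no boundedness has to be required of the functions in `H_v^0`. -/
theorem MemHZero.memHInf {v : Weight} {f : ℂ → ℂ} (hf : MemHZero v f) : MemHInf v f := by
  refine ⟨hf.1, ?_⟩
  have hc : Continuous fun z => v z * ‖f z‖ :=
    v.continuous_radial.mul hf.1.continuous.norm
  have h1 : ∀ᶠ z in cocompact ℂ, v z * ‖f z‖ < 1 := hf.2.eventually_lt_const one_pos
  obtain ⟨K, hK, hKs⟩ := mem_cocompact.1 h1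
  obtain ⟨C, hC⟩ := hK.bddAbove_image hc.continuousOn
  refine ⟨max C 1, ?_⟩
  rintro _ ⟨z, rfl⟩
  by_cases hz : z ∈ K
  · exact le_max_of_le_left (hC ⟨z, hz, rfl⟩)
  · exact le_max_of_le_right (le_of_lt (hKs hz))

/-- `H_v^∞` as a linear space of functions. -/
def hInfSubmodule (v : Weight) : Submodule ℂ (ℂ → ℂ) where
  carrier := {f | MemHInf v f}
  zero_mem' := ⟨differentiable_const 0, 0, by rintro _ ⟨z, rfl⟩; simp⟩
  add_mem' := by
    rintro f g ⟨hf, A, hA⟩ ⟨hg, B, hB⟩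
    refine ⟨hf.add hg, A + B, ?_⟩
    rintro _ ⟨z, rfl⟩
    have h1 : v z * ‖f z‖ ≤ A := hA ⟨z, rfl⟩
    have h2 : v z * ‖g z‖ ≤ B := hB ⟨z, rfl⟩
    have h3 := mul_le_mul_of_nonneg_left (norm_add_le (f z) (g z)) (v.radial_pos z).le
    simp only [Pi.add_apply]
    linarith
  smul_mem' := by
    rintro c f ⟨hf, A, hA⟩
    refine ⟨hf.const_smul c, ‖c‖ * A, ?_⟩
    rintro _ ⟨z, rfl⟩
    have h1 : v z * ‖f z‖ ≤ A := hA ⟨z, rfl⟩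
    have h2 := mul_le_mul_of_nonneg_left h1 (norm_nonneg c)
    simp only [Pi.smul_apply, smul_eq_mul, norm_mul]
    linarith

/-- The weighted Banach space `H_v^∞` of entire functions. It is a type of its own, so that it
carries the weighted sup norm and not the topology of pointwise convergence. -/
def HInf (v : Weight) : Type := ↥(hInfSubmodule v)

namespace HInf

variable {v : Weight}

instance : AddCommGroup (HInf v) := inferInstanceAs (AddCommGroup ↥(hInfSubmodule v))

instance : Module ℂ (HInf v) := inferInstanceAs (Module ℂ ↥(hInfSubmodule v))

instance : CoeFun (HInf v) (fun _ => ℂ → ℂ) := ⟨fun f => f.1⟩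

@[ext] theorem ext {f g : HInf v} (h : ∀ z, f z = g z) : f = g := Subtype.ext (funext h)

theorem add_apply (f g : HInf v) (z : ℂ) : (f + g) z = f z + g z := rfl

theorem smul_apply (c : ℂ) (f : HInf v) (z : ℂ) : (c • f) z = c * f z := rfl

theorem zero_apply (z : ℂ) : (0 : HInf v) z = 0 := rfl

/-- The weighted sup norm `‖f‖_v = sup_z v(z) |f(z)|`. -/
instance : Norm (HInf v) := ⟨fun f => ⨆ z : ℂ, v z * ‖f z‖⟩

theorem norm_def (f : HInf v) : ‖f‖ = ⨆ z : ℂ, v z * ‖f z‖ := rfl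

theorem le_norm (f : HInf v) (z : ℂ) : v z * ‖f z‖ ≤ ‖f‖ := le_ciSup f.2.2 z

theorem norm_core : NormedSpace.Core ℂ (HInf v) where
  norm_nonneg f := Real.iSup_nonneg fun z => mul_nonneg (v.radial_pos z).le (norm_nonneg _)
  norm_smul c f := by
    rw [norm_def, norm_def, Real.mul_iSup_of_nonneg (norm_nonneg c)]
    refine iSup_congr fun z => ?_
    rw [smul_apply, norm_mul]
    ring
  norm_triangle f g := by
    refine ciSup_le fun z => ?_
    have h1 := le_norm f z
    have h2 := le_norm g z
    have h3 := mul_le_mul_of_nonneg_left (norm_add_le (f z) (g z)) (v.radial_pos z).le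
    rw [add_apply]
    linarith
  norm_eq_zero_iff f := by
    constructor
    · intro h
      ext z
      have h1 := le_norm f z
      rw [h] at h1
      have h2 : ‖f z‖ ≤ 0 := nonpos_of_mul_nonpos_right h1 (v.radial_pos z)
      simpa [zero_apply] using h2
    · rintro rfl
      simp [norm_def, zero_apply]

instance : NormedAddCommGroup (HInf v) := NormedAddCommGroup.ofCore norm_core

instance : NormedSpace ℂ (HInf v) := NormedSpace.ofCore norm_core

end HInf

/-- The space `H_v^0`, a subspace of `H_v^∞` with the same norm. -/
def HZero (v : Weight) : Submodule ℂ (HInf v) where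
  carrier := {f | MemHZero v f}
  zero_mem' := ⟨differentiable_const 0, by simp [HInf.zero_apply]⟩
  add_mem' := by
    rintro f g ⟨hf, hf0⟩ ⟨hg, hg0⟩
    refine ⟨hf.add hg, squeeze_zero
      (fun z => mul_nonneg (v.radial_pos z).le (norm_nonneg _)) (fun z => ?_)
      (by simpa using hf0.add hg0)⟩
    have h3 := mul_le_mul_of_nonneg_left (norm_add_le (f z) (g z)) (v.radial_pos z).le
    rw [HInf.add_apply]
    linarith
  smul_mem' := by
    rintro c f ⟨hf, hf0⟩
    refine ⟨hf.const_smul c, ?_⟩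
    have h := hf0.const_mul ‖c‖
    rw [mul_zero] at h
    refine h.congr fun z => ?_
    rw [HInf.smul_apply, norm_mul]
    ring

/-- The associated weight `ṽ(z) = (sup {|f(z)| : f ∈ H_v^∞, ‖f‖_v ≤ 1})⁻¹`. -/
def assocWeight (v : Weight) (z : ℂ) : ℝ :=
  (sSup ((fun f : HInf v => ‖f z‖) '' {f | ‖f‖ ≤ 1}))⁻¹

/-- A sequence `z` is interpolating for `H_u^∞`, where `u` is a weight function on the plane. -/
def IsInterpolating (u : ℂ → ℝ) (z : ℕ → ℂ) : Prop :=
  ∀ α : ℕ → ℂ, BddAbove (Set.range fun j => u (z j) * ‖α j‖) →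
    ∃ f : ℂ → ℂ, MemHInf u f ∧ ∀ j, f (z j) = α j

/-- A discrete sequence in the plane: its points are distinct and do not accumulate anywhere
in the plane. -/
def IsDiscreteSeq (z : ℕ → ℂ) : Prop :=
  Function.Injective z ∧ Tendsto z atTop (cocompact ℂ)

/-- Every discrete sequence in the plane has a subsequence interpolating for `H_u^∞`. -/
def HasInterpolatingSubseqs (u : ℂ → ℝ) : Prop :=
  ∀ z : ℕ → ℂ, IsDiscreteSeq z → ∃ φ : ℕ → ℕ, StrictMono φ ∧ IsInterpolating u (z ∘ φ)

/-- A bounded operator is weakly compact if it maps the closed unit ball to a relatively weakly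
compact set. -/
def IsWeaklyCompactOperator {E F : Type*} [NormedAddCommGroup E] [NormedSpace ℂ E]
    [NormedAddCommGroup F] [NormedSpace ℂ F] (T : E →L[ℂ] F) : Prop :=
  IsCompact (closure (toWeakSpace ℂ F '' (T '' Metric.closedBall 0 1)))

/-- `T` is the multiplication operator `M_h f = h f` from `H_v^∞` to `H_w^∞`. -/
def IsMulOp {v w : Weight} (h : ℂ → ℂ) (T : HInf v →L[ℂ] HInf w) : Prop :=
  ∀ (f : HInf v) (z : ℂ), T f z = h z * f z

/-- `T` is the multiplication operator `M_h f = h f` from `H_v^0` to `H_w^0`. -/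
def IsMulOpZero {v w : Weight} (h : ℂ → ℂ) (T : HZero v →L[ℂ] HZero w) : Prop :=
  ∀ (f : HZero v) (z : ℂ), (T f : HInf w) z = h z * (f : HInf v) z

end WeightedEntire

end

open WeightedEntire

namespace WeightedEntire

/-! Everything rests on the Fejér means `S_n` of the Taylor series. Each `S_n` is a finite rank
contraction on `H_v^∞` for `n ≠ 0`, because averaging over rotations cannot raise the maximum
modulus on a circle and `v` is radial. Its range consists of polynomials, hence lies in `H_v^0`, and
`S_n f → f` uniformly on discs at a rate controlled by `‖f‖_v`. So polynomials are dense in `H_v^0`,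
the unit ball of `H_v^0` already determines `ṽ`, and functions in `H_v^0` decay even against the
larger `ṽ`.

The first four conditions form a cycle 1 → 2 → 4 → 3 → 1. A bounded `M_h` satisfies `w|h| ≤ ‖M_h‖
ṽ`, so it restricts to the small spaces. A totally bounded set in `H_w^0` decays uniformly against
`w̃`; applied to the image of the unit ball, this is 4. Then `w ≤ w̃` gives 3, and 3 makes `M_h` the
norm limit of the finite rank operators `M_h S_n`.

Under weak compactness, a weak cluster point of `M_h S_n f` lies in `H_w^0`, and point evaluations
identify it with `hf`. Hence `hf` decays against `w` for every `f` in `H_v^∞`. If 3 failed along a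
sequence, a function interpolating `1/ṽ` on a subsequence would contradict this decay. -/

/-! ### Taylor coefficients, the Fejér kernel and Fejér means -/

/-- The `k`-th Taylor coefficient of `f` at the origin. -/
noncomputable def taylorCoeff (k : ℕ) (f : ℂ → ℂ) : ℂ := (k.factorial : ℂ)⁻¹ * iteratedDeriv k f 0

/-- The `n`-th Fejér mean of the Taylor series of `f`: the average of its first `n` partial sums. -/
noncomputable def fejerMean (n : ℕ) (f : ℂ → ℂ) (z : ℂ) : ℂ :=
  (n : ℂ)⁻¹ * ∑ l ∈ Finset.range n, ∑ k ∈ Finset.range (l + 1), taylorCoeff k f * z ^ k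

theorem hasSum_taylorCoeff {f : ℂ → ℂ} (hf : Differentiable ℂ f) (z : ℂ) :
    HasSum (fun k => taylorCoeff k f * z ^ k) (f z) := by
  convert! Complex.hasSum_taylorSeries_of_entire hf 0 z using 2 with k
  simp only [taylorCoeff, sub_zero, smul_eq_mul]
  ring

theorem norm_taylorCoeff_le {f : ℂ → ℂ} (hf : Differentiable ℂ f) {R M : ℝ} (hR : 0 < R)
    (hM : ∀ z, ‖z‖ = R → ‖f z‖ ≤ M) (k : ℕ) : ‖taylorCoeff k f‖ ≤ M / R ^ k := by
  have h := Complex.norm_iteratedDeriv_le_of_forall_mem_sphere_norm_le k hR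
    (hf.diffContOnCl (s := Metric.ball 0 R)) (fun z hz => hM z (by simpa using hz))
  have hk : (0 : ℝ) < k.factorial := by positivity
  rw [taylorCoeff, norm_mul, norm_inv, Complex.norm_natCast]
  calc _ ≤ (k.factorial : ℝ)⁻¹ * (k.factorial * M / R ^ k) := by gcongr
    _ = _ := by field_simp

theorem taylorCoeff_add {f g : ℂ → ℂ} (hf : Differentiable ℂ f) (hg : Differentiable ℂ g) (k : ℕ) :
    taylorCoeff k (f + g) = taylorCoeff k f + taylorCoeff k g := by
  rw [taylorCoeff, iteratedDeriv_add hf.contDiff.contDiffAt hg.contDiff.contDiffAt, mul_add]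
  rfl

theorem taylorCoeff_const_smul (c : ℂ) (f : ℂ → ℂ) (k : ℕ) :
    taylorCoeff k (c • f) = c * taylorCoeff k f := by
  rw [taylorCoeff, iteratedDeriv_const_smul_field, taylorCoeff, smul_eq_mul]
  ring

theorem taylorCoeff_comp_const_mul {f : ℂ → ℂ} (hf : Differentiable ℂ f) (c : ℂ) (k : ℕ) :
    taylorCoeff k (fun u => f (c * u)) = taylorCoeff k f * c ^ k := by
  rw [taylorCoeff, iteratedDeriv_comp_const_mul hf.contDiff, taylorCoeff]
  simp only [mul_zero]
  ring

/-- Cauchy's formula for derivatives: the average is taken against `du / (2πi u)`, which raises the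
pole to order `k + 1`. -/
theorem circleAverage_inv_pow_mul {g : ℂ → ℂ} (hg : Differentiable ℂ g) (k : ℕ) :
    Real.circleAverage (fun u => u⁻¹ ^ k * g u) 0 1 = taylorCoeff k g := by
  have h := DiffContOnCl.circleIntegral_one_div_sub_center_pow_smul one_pos k
    (hg.diffContOnCl (s := Metric.ball 0 1))
  have hk : (k.factorial : ℂ) ≠ 0 := by exact_mod_cast k.factorial_ne_zero
  have hpi := Complex.two_pi_I_ne_zero
  rw [Real.circleAverage_eq_circleIntegral one_ne_zero, taylorCoeff]
  have : (fun z : ℂ => (z - 0)⁻¹ • (z⁻¹ ^ k * g z)) =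
      fun z => (1 / (z - 0) ^ (k + 1)) • g z := by
    funext z
    simp only [sub_zero, smul_eq_mul, one_div, inv_pow, pow_succ, mul_inv]
    ring
  rw [this, h]
  simp only [smul_eq_mul]
  field_simp

/-- Mean value property of an entire function that vanishes at the origin. -/
theorem circleAverage_pow_mul {g : ℂ → ℂ} (hg : Differentiable ℂ g) {m : ℕ} (hm : m ≠ 0) :
    Real.circleAverage (fun u => u ^ m * g u) 0 1 = 0 := by
  have h := DiffContOnCl.circleAverage (c := 0) (R := 1)
    (((differentiable_id.pow m).mul hg).diffContOnCl (s := Metric.ball (0 : ℂ) |1|))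
  simpa [hm, Pi.mul_def, Pi.pow_def] using h

theorem continuousOn_inv_pow_sphere (k : ℕ) :
    ContinuousOn (fun u : ℂ => u⁻¹ ^ k) (Metric.sphere 0 |1|) := by
  refine ContinuousOn.pow (continuousOn_inv₀.mono fun u hu => ?_) k
  rintro rfl
  simp at hu

theorem circleAverage_pow_mul_inv_pow_mul {g : ℂ → ℂ} (hg : Differentiable ℂ g) (j l : ℕ) :
    Real.circleAverage (fun u => u ^ j * u⁻¹ ^ l * g u) 0 1 =
      if j ≤ l then taylorCoeff (l - j) g else 0 := by
  split_ifs with hjl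
  · rw [← circleAverage_inv_pow_mul hg]
    refine Real.circleAverage_congr_sphere fun u hu => ?_
    have hu0 : u ≠ 0 := by rintro rfl; simp at hu
    obtain ⟨d, rfl⟩ := Nat.exists_eq_add_of_le hjl
    simp only [Nat.add_sub_cancel_left, pow_add, inv_pow]
    field_simp
  · push Not at hjl
    refine Eq.trans ?_ (circleAverage_pow_mul hg (Nat.sub_ne_zero_of_lt hjl))
    refine Real.circleAverage_congr_sphere fun u hu => ?_
    have hu0 : u ≠ 0 := by rintro rfl; simp at hu
    obtain ⟨d, rfl⟩ := Nat.exists_eq_add_of_le hjl.le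
    simp only [Nat.add_sub_cancel_left, pow_add, inv_pow]
    field_simp

/-- The Fejér kernel on the unit circle, up to the factor `1 / n`. -/
noncomputable def fejerKernel (n : ℕ) (u : ℂ) : ℝ := ‖∑ j ∈ Finset.range n, u ^ j‖ ^ 2

theorem fejerKernel_eq {u : ℂ} (hu : ‖u‖ = 1) (n : ℕ) :
    (fejerKernel n u : ℂ) =
      ∑ l ∈ Finset.range n, ∑ j ∈ Finset.range n, u ^ j * u⁻¹ ^ l := by
  have hconj : (starRingEnd ℂ) u = u⁻¹ := by
    rw [Complex.inv_def, Complex.normSq_eq_norm_sq, hu]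
    simp
  rw [fejerKernel, Complex.ofReal_pow, ← Complex.mul_conj', map_sum, Finset.sum_mul_sum,
    Finset.sum_comm]
  simp [hconj]

/-- In the expanded kernel, the terms with fixed `l` extract the coefficients of index `l - j` for
`j ≤ l`, that is, the `l`-th partial sum at `1`. -/
theorem circleAverage_fejerKernel_mul {g : ℂ → ℂ} (hg : Differentiable ℂ g) (n : ℕ) :
    Real.circleAverage (fun u => (fejerKernel n u : ℂ) * g u) 0 1 =
      ∑ l ∈ Finset.range n, ∑ k ∈ Finset.range (l + 1), taylorCoeff k g := by
  have hint : ∀ l j : ℕ, CircleIntegrable (fun u => u ^ j * u⁻¹ ^ l * g u) 0 1 := fun l j => by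
    refine ContinuousOn.circleIntegrable' ?_
    exact ((continuous_pow j).continuousOn.mul (continuousOn_inv_pow_sphere l)).mul
      hg.continuous.continuousOn
  have h1 : Set.EqOn (fun u => (fejerKernel n u : ℂ) * g u)
      (fun u => ∑ l ∈ Finset.range n, ∑ j ∈ Finset.range n, u ^ j * u⁻¹ ^ l * g u)
      (Metric.sphere 0 |1|) := by
    intro u hu
    have hu1 : ‖u‖ = 1 := by simpa using hu
    simp only [fejerKernel_eq hu1, Finset.sum_mul]
  rw [Real.circleAverage_congr_sphere h1, Real.circleAverage_fun_sum]
  · refine Finset.sum_congr rfl fun l hl => ?_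
    rw [Real.circleAverage_fun_sum fun j _ => hint l j]
    simp only [circleAverage_pow_mul_inv_pow_mul hg]
    rw [← Finset.sum_filter]
    have : (Finset.range n).filter (· ≤ l) = Finset.range (l + 1) := by
      ext j
      simp only [Finset.mem_filter, Finset.mem_range] at hl ⊢
      omega
    rw [this, ← Finset.sum_range_reflect]
    refine Finset.sum_congr rfl fun j hj => ?_
    simp only [Finset.mem_range] at hj
    congr 1
    omega
  · intro l _
    exact CircleIntegrable.fun_sum _ fun j _ => hint l j

theorem continuous_fejerKernel (n : ℕ) : Continuous (fejerKernel n) := by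
  unfold fejerKernel
  fun_prop

theorem circleAverage_fejerKernel (n : ℕ) : Real.circleAverage (fejerKernel n) 0 1 = n := by
  have h := circleAverage_fejerKernel_mul (differentiable_const (1 : ℂ)) n
  have h0 : ∀ k, taylorCoeff k (fun _ : ℂ => (1 : ℂ)) = if k = 0 then 1 else 0 := by
    intro k
    rw [taylorCoeff, iteratedDeriv_const]
    split_ifs with hk <;> simp [hk]
  have h2 := Complex.ofRealCLM.circleAverage_comp_comm
    ((continuous_fejerKernel n).continuousOn.circleIntegrable' (c := 0) (R := 1))
  have h3 : ((Real.circleAverage (fejerKernel n) 0 1 : ℝ) : ℂ) = n := by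
    rw [← Complex.ofRealCLM_apply, ← h2]
    simpa [h0, Function.comp_def] using h
  exact_mod_cast h3

theorem norm_circleAverage_le {φ : ℂ → ℂ} :
    ‖Real.circleAverage φ 0 1‖ ≤ Real.circleAverage (fun u => ‖φ u‖) 0 1 := by
  rw [Real.circleAverage, Real.circleAverage, norm_smul, smul_eq_mul, Real.norm_of_nonneg
    (by positivity)]
  gcongr
  exact intervalIntegral.norm_integral_le_integral_norm Real.two_pi_pos.le

/-- Fejér means do not increase the maximum modulus on circles around the origin. -/
theorem norm_fejerMean_le {f : ℂ → ℂ} (hf : Differentiable ℂ f) {n : ℕ} (hn : n ≠ 0) {z : ℂ} {M : ℝ}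
    (hM : ∀ ζ, ‖ζ‖ = ‖z‖ → ‖f ζ‖ ≤ M) : ‖fejerMean n f z‖ ≤ M := by
  have hn' : (0 : ℝ) < n := by positivity
  -- Rescaling moves the circle through `z` to the unit circle and turns the coefficients into
  -- `taylorCoeff k f * z ^ k`.
  have hg : Differentiable ℂ fun u => f (z * u) := hf.comp (by fun_prop)
  have h1 := circleAverage_fejerKernel_mul hg n
  simp only [taylorCoeff_comp_const_mul hf] at h1
  have h2 : ‖Real.circleAverage (fun u => (fejerKernel n u : ℂ) * f (z * u)) 0 1‖ ≤ n * M := by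
    refine norm_circleAverage_le.trans ?_
    calc _ ≤ Real.circleAverage (fun u => M • fejerKernel n u) 0 1 := by
          refine Real.circleAverage_mono ?_ ?_ fun u hu => ?_
          · refine ContinuousOn.circleIntegrable' (Continuous.continuousOn ?_)
            exact ((Complex.continuous_ofReal.comp (continuous_fejerKernel n)).mul
              hg.continuous).norm
          · refine ContinuousOn.circleIntegrable' (Continuous.continuousOn ?_)
            exact (continuous_fejerKernel n).const_smul M
          · have hu1 : ‖u‖ = 1 := by simpa using hu
            have hK : 0 ≤ fejerKernel n u := sq_nonneg _
            rw [norm_mul, Complex.norm_real, Real.norm_of_nonneg hK, smul_eq_mul, mul_comm M]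
            exact mul_le_mul_of_nonneg_left (hM _ (by simp [hu1])) hK
      _ = n * M := by
          rw [Real.circleAverage_fun_smul, circleAverage_fejerKernel, smul_eq_mul, mul_comm]
  rw [fejerMean, ← h1, norm_mul, norm_inv, Complex.norm_natCast, inv_mul_le_iff₀ hn']
  exact h2

/-- Cauchy's estimates at radius `2R` bound the error of the `l`-th partial sum on `|z| ≤ R` by `M /
2 ^ l`; averaging these errors gives `2M / n`. The bound sees `f` only through `M`, so it is uniform
over norm balls. -/
theorem norm_fejerMean_sub_le {f : ℂ → ℂ} (hf : Differentiable ℂ f) {n : ℕ} (hn : n ≠ 0)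
    {R M : ℝ} (hR : 0 < R) (hM : ∀ ζ, ‖ζ‖ = 2 * R → ‖f ζ‖ ≤ M) {z : ℂ} (hz : ‖z‖ ≤ R) :
    ‖fejerMean n f z - f z‖ ≤ 2 * M / n := by
  have hn' : (0 : ℝ) < n := by positivity
  have hnC : (n : ℂ) ≠ 0 := by exact_mod_cast hn
  have hM0 : 0 ≤ M := (norm_nonneg _).trans (hM ((2 * R : ℝ) : ℂ) (by simp [abs_of_pos hR]))
  have hcoeff : ∀ k, ‖taylorCoeff k f * z ^ k‖ ≤ M * (1 / 2) ^ k := fun k => by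
    rw [norm_mul, norm_pow]
    calc _ ≤ M / (2 * R) ^ k * R ^ k := by
          gcongr
          exact norm_taylorCoeff_le hf (by positivity) hM k
      _ = _ := by
          rw [mul_pow, div_pow, one_pow]
          field_simp
  have htail : ∀ l, ‖(∑ k ∈ Finset.range (l + 1), taylorCoeff k f * z ^ k) - f z‖ ≤
      M * (1 / 2) ^ l := fun l => by
    refine (norm_sub_le_of_geometric_bound_of_hasSum (by norm_num) hcoeff
      (hasSum_taylorCoeff hf z) (l + 1)).trans_eq ?_
    rw [pow_succ]
    ring
  have hsum : ∑ l ∈ Finset.range n, (1 / 2 : ℝ) ^ l ≤ 2 := by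
    have := Summable.sum_le_tsum (f := fun l : ℕ => (1 / 2 : ℝ) ^ l) (Finset.range n)
      (fun _ _ => by positivity) summable_geometric_two
    rwa [tsum_geometric_two] at this
  have hrw : fejerMean n f z - f z = (n : ℂ)⁻¹ * ∑ l ∈ Finset.range n,
      ((∑ k ∈ Finset.range (l + 1), taylorCoeff k f * z ^ k) - f z) := by
    rw [Finset.sum_sub_distrib, fejerMean, mul_sub, Finset.sum_const, Finset.card_range,
      nsmul_eq_mul, inv_mul_cancel_left₀ hnC]
  rw [hrw, norm_mul, norm_inv, Complex.norm_natCast, inv_mul_le_iff₀ hn']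
  calc _ ≤ ∑ l ∈ Finset.range n, M * (1 / 2 : ℝ) ^ l :=
        norm_sum_le_of_le _ fun l _ => htail l
    _ ≤ M * 2 := by
        rw [← Finset.mul_sum]
        gcongr
    _ = n * (2 * M / n) := by field_simp

/-! ### Fejér mean operators on the weighted spaces -/

variable {v : Weight}

theorem Weight.radial_eq_of_norm_eq (v : Weight) {z ζ : ℂ} (h : ‖ζ‖ = ‖z‖) : v ζ = v z :=
  congrArg v.toFun (NNReal.eq h)

theorem Weight.radial_le_of_norm_le (v : Weight) {z ζ : ℂ} (h : ‖ζ‖ ≤ ‖z‖) : v z ≤ v ζ :=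
  v.antitone h

theorem Weight.tendsto_mul_norm_pow (v : Weight) (k : ℕ) :
    Tendsto (fun z : ℂ => v z * ‖z ^ k‖) (cocompact ℂ) (𝓝 0) := by
  have h : Tendsto (fun z : ℂ => ‖z‖₊) (cocompact ℂ) atTop :=
    NNReal.tendsto_coe_atTop.1 tendsto_norm_cocompact_atTop
  refine ((v.decay k).comp h).congr fun z => ?_
  simp only [Function.comp_apply, coe_nnnorm, norm_pow, Weight.radial]
  ring

namespace HInf

theorem sub_apply (f g : HInf v) (z : ℂ) : (f - g) z = f z - g z := rfl

theorem norm_le_of_forall_le {f : HInf v} {C : ℝ} (h : ∀ z, v z * ‖f z‖ ≤ C) : ‖f‖ ≤ C :=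
  ciSup_le h

theorem norm_apply_le (f : HInf v) (z : ℂ) : ‖f z‖ ≤ ‖f‖ / v z := by
  rw [le_div_iff₀ (v.radial_pos z), mul_comm]
  exact le_norm f z

/-- Point evaluation. -/
noncomputable def evalCLM (v : Weight) (z : ℂ) : HInf v →L[ℂ] ℂ :=
  LinearMap.mkContinuous
    { toFun := fun f => f z
      map_add' := fun _ _ => rfl
      map_smul' := fun _ _ => rfl } (v z)⁻¹ fun f => by
    rw [inv_mul_eq_div]
    exact norm_apply_le f z

theorem evalCLM_apply (z : ℂ) (f : HInf v) : evalCLM v z f = f z := rfl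

/-- If `u` is dominated by the norm of `H_v^∞`, then decay against `u` passes to norm limits. -/
theorem tendsto_mul_norm_of_approx {u : ℂ → ℝ} (hu : ∀ z, 0 ≤ u z)
    (hle : ∀ (f : HInf v) z, u z * ‖f z‖ ≤ ‖f‖) {f : HInf v}
    (h : ∀ ε > 0, ∃ g : HInf v, ‖f - g‖ < ε ∧
      Tendsto (fun z => u z * ‖g z‖) (cocompact ℂ) (𝓝 0)) :
    Tendsto (fun z => u z * ‖f z‖) (cocompact ℂ) (𝓝 0) := by
  rw [Metric.tendsto_nhds]
  intro ε hε
  obtain ⟨g, hfg, hg⟩ := h (ε / 2) (half_pos hε)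
  filter_upwards [hg.eventually_lt_const (half_pos hε)] with z hz
  have h1 := hle (f - g) z
  have h2 : ‖f z‖ ≤ ‖(f - g) z‖ + ‖g z‖ := by
    rw [sub_apply]
    simpa using norm_add_le (f z - g z) (g z)
  have h3 := mul_le_mul_of_nonneg_left h2 (hu z)
  rw [Real.dist_0_eq_abs, abs_of_nonneg (mul_nonneg (hu z) (norm_nonneg _))]
  linarith

/-- The monomial `z ^ k` as an element of `H_v^∞`. -/
def monomial (v : Weight) (k : ℕ) : HInf v :=
  ⟨fun z => z ^ k, MemHZero.memHInf ⟨differentiable_pow k, v.tendsto_mul_norm_pow k⟩⟩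

theorem monomial_apply (k : ℕ) (z : ℂ) : monomial v k z = z ^ k := rfl

/-- The `k`-th Taylor coefficient as a functional on `H_v^∞`. -/
noncomputable def coeffCLM (v : Weight) (k : ℕ) : HInf v →L[ℂ] ℂ :=
  LinearMap.mkContinuous
    { toFun := fun f => taylorCoeff k f
      map_add' := fun f g => taylorCoeff_add f.2.1 g.2.1 k
      map_smul' := fun c f => taylorCoeff_const_smul c f k } (v 1)⁻¹ fun f => by
    have h := norm_taylorCoeff_le f.2.1 one_pos (M := ‖f‖ / v 1) (fun z hz => by
      rw [← v.radial_eq_of_norm_eq (z := 1) (ζ := z) (by simpa using hz)]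
      exact norm_apply_le f z) k
    rw [one_pow, div_one, ← inv_mul_eq_div] at h
    exact h

/-- The Fejér mean operator on `H_v^∞`. -/
noncomputable def fejerCLM (v : Weight) (n : ℕ) : HInf v →L[ℂ] HInf v :=
  (n : ℂ)⁻¹ • ∑ l ∈ Finset.range n, ∑ k ∈ Finset.range (l + 1),
    (coeffCLM v k).smulRight (monomial v k)

theorem fejerCLM_apply (n : ℕ) (f : HInf v) (z : ℂ) : fejerCLM v n f z = fejerMean n f z := by
  rw [← evalCLM_apply, fejerCLM, fejerMean]
  simp only [_root_.smul_apply, _root_.sum_apply, map_smul, map_sum,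
    ContinuousLinearMap.smulRight_apply, evalCLM_apply, monomial_apply, smul_eq_mul]
  rfl

/-- A finite linear combination of rank one operators, each factoring through `ℂ`. -/
theorem isCompactOperator_fejerCLM (n : ℕ) : IsCompactOperator (fejerCLM v n) := by
  change fejerCLM v n ∈ compactOperator (RingHom.id ℂ) (HInf v) (HInf v)
  refine Submodule.smul_mem _ _ (Submodule.sum_mem _ fun l _ => Submodule.sum_mem _ fun k _ => ?_)
  have h : IsCompactOperator (ContinuousLinearMap.toSpanSingleton ℂ (monomial v k)) :=
    isCompactOperator_of_locallyCompactSpace_rng _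
  exact h.comp_clm (coeffCLM v k)

theorem norm_fejerCLM_apply_le {n : ℕ} (hn : n ≠ 0) (f : HInf v) : ‖fejerCLM v n f‖ ≤ ‖f‖ := by
  refine norm_le_of_forall_le fun z => ?_
  have h := norm_fejerMean_le f.2.1 hn (z := z) (M := ‖f‖ / v z) fun ζ hζ => by
    rw [← v.radial_eq_of_norm_eq hζ]
    exact norm_apply_le f ζ
  rwa [fejerCLM_apply, mul_comm, ← le_div_iff₀ (v.radial_pos z)]

theorem norm_fejerCLM_apply_sub_le {n : ℕ} (hn : n ≠ 0) (f : HInf v) {R : ℝ} (hR : 0 < R) {z : ℂ}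
    (hz : ‖z‖ ≤ R) : ‖fejerCLM v n f z - f z‖ ≤ 2 * (‖f‖ / v (2 * R : ℝ)) / n := by
  rw [fejerCLM_apply]
  refine norm_fejerMean_sub_le f.2.1 hn hR (fun ζ hζ => ?_) hz
  rw [← v.radial_eq_of_norm_eq (z := (2 * R : ℝ)) (ζ := ζ)
    (by rw [hζ, Complex.norm_real, Real.norm_of_nonneg (by positivity)])]
  exact norm_apply_le f ζ

theorem tendsto_fejerCLM_apply (f : HInf v) (z : ℂ) :
    Tendsto (fun n => fejerCLM v n f z) atTop (𝓝 (f z)) := by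
  rw [tendsto_iff_norm_sub_tendsto_zero]
  refine squeeze_zero' (.of_forall fun _ => norm_nonneg _) ?_
    (tendsto_const_div_atTop_nhds_zero_nat (2 * (‖f‖ / v (2 * (‖z‖ + 1) : ℝ))))
  filter_upwards [eventually_ne_atTop 0] with n hn
  exact norm_fejerCLM_apply_sub_le hn f (by positivity) (by linarith)

end HInf

/-- Stated for a general `u` because it serves both `v` and `ṽ`. -/
theorem tendsto_mul_norm_fejerMean {u : ℂ → ℝ} (hu : ∀ z, 0 ≤ u z)
    (h : ∀ k : ℕ, Tendsto (fun z : ℂ => u z * ‖z ^ k‖) (cocompact ℂ) (𝓝 0)) (n : ℕ) (f : ℂ → ℂ) :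
    Tendsto (fun z => u z * ‖fejerMean n f z‖) (cocompact ℂ) (𝓝 0) := by
  have h1 : Tendsto (fun z => ‖(n : ℂ)⁻¹‖ * ∑ l ∈ Finset.range n, ∑ k ∈ Finset.range (l + 1),
      ‖taylorCoeff k f‖ * (u z * ‖z ^ k‖)) (cocompact ℂ) (𝓝 0) := by
    have := (tendsto_finsetSum (Finset.range n) fun l _ =>
      tendsto_finsetSum (Finset.range (l + 1)) fun k _ =>
        (h k).const_mul ‖taylorCoeff k f‖).const_mul ‖(n : ℂ)⁻¹‖
    simpa using this
  refine squeeze_zero (fun z => mul_nonneg (hu z) (norm_nonneg _)) (fun z => ?_) h1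
  rw [fejerMean, norm_mul, mul_left_comm]
  gcongr
  have h2 : ‖∑ l ∈ Finset.range n, ∑ k ∈ Finset.range (l + 1), taylorCoeff k f * z ^ k‖ ≤
      ∑ l ∈ Finset.range n, ∑ k ∈ Finset.range (l + 1), ‖taylorCoeff k f‖ * ‖z ^ k‖ :=
    norm_sum_le_of_le _ fun l _ => norm_sum_le_of_le _ fun k _ => norm_mul_le _ _
  refine (mul_le_mul_of_nonneg_left h2 (hu z)).trans_eq ?_
  simp only [Finset.mul_sum]
  exact Finset.sum_congr rfl fun l _ => Finset.sum_congr rfl fun k _ => by ring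

theorem fejerCLM_mem_HZero (n : ℕ) (f : HInf v) : HInf.fejerCLM v n f ∈ HZero v := by
  refine ⟨(HInf.fejerCLM v n f).2.1, ?_⟩
  simp only [HInf.fejerCLM_apply]
  exact tendsto_mul_norm_fejerMean (fun z => (v.radial_pos z).le) v.tendsto_mul_norm_pow n f

/-- On a large disc the quantitative estimate applies; outside it, `S_n f` inherits the smallness of
`v|f|` circle by circle. -/
theorem tendsto_fejerCLM_of_mem_HZero {f : HInf v} (hf : f ∈ HZero v) :
    Tendsto (fun n => HInf.fejerCLM v n f) atTop (𝓝 f) := by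
  rw [tendsto_iff_norm_sub_tendsto_zero, Metric.tendsto_nhds]
  intro ε hε
  have h1 : ∀ᶠ z in cocompact ℂ, v z * ‖f z‖ < ε / 4 := hf.2.eventually_lt_const (by positivity)
  obtain ⟨R, hR, hfR⟩ : ∃ R > 0, ∀ z : ℂ, R ≤ ‖z‖ → v z * ‖f z‖ < ε / 4 := by
    rw [← Metric.cobounded_eq_cocompact, ← comap_norm_atTop] at h1
    obtain ⟨R, hR⟩ := eventually_atTop.1 (eventually_comap.1 h1)
    exact ⟨max R 1, by positivity, fun z hz => hR ‖z‖ ((le_max_left _ _).trans hz) z rfl⟩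
  have h2 := (tendsto_const_div_atTop_nhds_zero_nat
    (2 * (‖f‖ / v (2 * R : ℝ)))).const_mul (v 0)
  rw [mul_zero] at h2
  filter_upwards [h2.eventually_lt_const (half_pos hε), eventually_ne_atTop 0] with n hn hn0
  have h3 : ‖HInf.fejerCLM v n f - f‖ ≤ ε / 2 := by
    refine HInf.norm_le_of_forall_le fun z => ?_
    rw [HInf.sub_apply]
    rcases le_total ‖z‖ R with hz | hz
    · refine le_trans ?_ hn.le
      exact mul_le_mul (v.radial_le_of_norm_le (by simp))
        (HInf.norm_fejerCLM_apply_sub_le hn0 f hR hz) (norm_nonneg _) (v.radial_pos 0).le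
    · have h4 := norm_fejerMean_le f.2.1 hn0 (z := z) (M := ε / 4 / v z) fun ζ hζ => by
        rw [← v.radial_eq_of_norm_eq hζ, le_div_iff₀ (v.radial_pos ζ), mul_comm]
        exact (hfR ζ (hζ ▸ hz)).le
      rw [le_div_iff₀ (v.radial_pos z), ← HInf.fejerCLM_apply] at h4
      have h5 := mul_le_mul_of_nonneg_left (norm_sub_le (HInf.fejerCLM v n f z) (f z))
        (v.radial_pos z).le
      have h6 := hfR z hz
      linarith
  rw [Real.dist_0_eq_abs, abs_of_nonneg (norm_nonneg _)]
  linarith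

/-! ### Closedness of `H_v^0` and completeness of `H_v^∞` -/

theorem isClosed_HZero (v : Weight) : IsClosed (HZero v : Set (HInf v)) := by
  refine isClosed_of_closure_subset fun f hf => ⟨f.2.1, ?_⟩
  refine HInf.tendsto_mul_norm_of_approx (fun z => (v.radial_pos z).le) HInf.le_norm fun ε hε => ?_
  obtain ⟨g, hg, hfg⟩ := Metric.mem_closure_iff.1 hf ε hε
  exact ⟨g, by rwa [← dist_eq_norm], hg.2⟩

/-- Since `v` is bounded below on discs, norm Cauchy sequences converge locally uniformly, so the
limit is entire. Completeness is what makes norm limits of compact operators compact. -/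
instance HInf.instCompleteSpace : CompleteSpace (HInf v) := by
  refine Metric.complete_of_cauchySeq_tendsto fun F hF => ?_
  have hpt : ∀ z, ∃ a, Tendsto (fun n => F n z) atTop (𝓝 a) := fun z =>
    cauchySeq_tendsto_of_complete ((HInf.evalCLM v z).uniformContinuous.comp_cauchySeq hF)
  choose g hg using hpt
  have hunif : ∀ ε > 0, ∃ N, ∀ n ≥ N, ∀ z, v z * ‖F n z - g z‖ ≤ ε := by
    intro ε hε
    obtain ⟨N, hN⟩ := Metric.cauchySeq_iff.1 hF ε hε
    refine ⟨N, fun n hn z => ?_⟩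
    refine le_of_tendsto (((tendsto_const_nhds.sub (hg z)).norm).const_mul (v z)) ?_
    filter_upwards [eventually_ge_atTop N] with m hm
    have h1 := HInf.le_norm (F n - F m) z
    have h2 := hN n hn m hm
    rw [dist_eq_norm] at h2
    rw [HInf.sub_apply] at h1
    linarith
  have hdiff : Differentiable ℂ g := by
    intro z₀
    have hloc : TendstoUniformlyOn (fun n z => F n z) g atTop (Metric.ball 0 (‖z₀‖ + 1)) := by
      rw [Metric.tendstoUniformlyOn_iff]
      intro ε hε
      set r : ℂ := ((‖z₀‖ + 1 : ℝ) : ℂ)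
      have hvr := v.radial_pos r
      obtain ⟨N, hN⟩ := hunif (v r * (ε / 2)) (by positivity)
      filter_upwards [eventually_ge_atTop N] with n hn z hz
      have h1 : v r ≤ v z := v.radial_le_of_norm_le (by
        rw [Complex.norm_real, Real.norm_of_nonneg (by positivity)]
        simpa using (Metric.mem_ball.1 hz).le)
      have h2 := (mul_le_mul_of_nonneg_right h1 (norm_nonneg (F n z - g z))).trans (hN n hn z)
      have h3 := le_of_mul_le_mul_left h2 hvr
      rw [dist_comm, dist_eq_norm]
      linarith
    refine (hloc.tendstoLocallyUniformlyOn.differentiableOn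
      (.of_forall fun n => (F n).2.1.differentiableOn) Metric.isOpen_ball).differentiableAt
      (Metric.isOpen_ball.mem_nhds (by simp))
  obtain ⟨N, hN⟩ := hunif 1 one_pos
  have hmem : MemHInf v g := by
    refine ⟨hdiff, ‖F N‖ + 1, ?_⟩
    rintro _ ⟨z, rfl⟩
    have h1 := HInf.le_norm (F N) z
    have h2 := hN N le_rfl z
    have h3 : ‖g z‖ ≤ ‖F N z‖ + ‖F N z - g z‖ := by
      simpa using norm_sub_le (F N z) (F N z - g z)
    have h4 := mul_le_mul_of_nonneg_left h3 (v.radial_pos z).le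
    change v z * ‖g z‖ ≤ _
    linarith
  let G : HInf v := ⟨g, hmem⟩
  refine ⟨G, tendsto_iff_norm_sub_tendsto_zero.2 (Metric.tendsto_atTop.2 ?_)⟩
  intro ε hε
  obtain ⟨N, hN⟩ := hunif (ε / 2) (half_pos hε)
  refine ⟨N, fun n hn => ?_⟩
  have h1 : ‖F n - G‖ ≤ ε / 2 := HInf.norm_le_of_forall_le (hN n hn)
  rw [Real.dist_0_eq_abs, abs_of_nonneg (norm_nonneg _)]
  linarith

/-! ### The associated weight -/

section AssocWeight

theorem bddAbove_norm_apply_unitBall (v : Weight) (z : ℂ) :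
    BddAbove ((fun f : HInf v => ‖f z‖) '' {f | ‖f‖ ≤ 1}) := by
  refine ⟨1 / v z, ?_⟩
  rintro _ ⟨f, hf, rfl⟩
  refine (HInf.norm_apply_le f z).trans ?_
  have := (v.radial_pos z).le
  gcongr
  exact hf

theorem norm_apply_le_inv_assocWeight {f : HInf v} (hf : ‖f‖ ≤ 1) (z : ℂ) :
    ‖f z‖ ≤ (assocWeight v z)⁻¹ := by
  rw [assocWeight, inv_inv]
  exact le_csSup (bddAbove_norm_apply_unitBall v z) ⟨f, hf, rfl⟩

theorem inv_assocWeight_le {z : ℂ} {C : ℝ} (h : ∀ f : HInf v, ‖f‖ ≤ 1 → ‖f z‖ ≤ C) :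
    (assocWeight v z)⁻¹ ≤ C := by
  rw [assocWeight, inv_inv]
  refine csSup_le ⟨_, 0, by simp, rfl⟩ ?_
  rintro _ ⟨f, hf, rfl⟩
  exact h f hf

theorem assocWeight_nonneg (v : Weight) (z : ℂ) : 0 ≤ assocWeight v z := by
  refine inv_nonneg.2 (Real.sSup_nonneg ?_)
  rintro _ ⟨f, -, rfl⟩
  exact norm_nonneg _

theorem norm_apply_le_norm_mul_inv_assocWeight (f : HInf v) (z : ℂ) :
    ‖f z‖ ≤ ‖f‖ * (assocWeight v z)⁻¹ := by
  rcases eq_or_ne f 0 with rfl | hf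
  · simp [HInf.zero_apply]
  have hf' : 0 < ‖f‖ := norm_pos_iff.2 hf
  have h := norm_apply_le_inv_assocWeight (f := ((‖f‖⁻¹ : ℝ) : ℂ) • f) (by
    rw [norm_smul, Complex.norm_real, norm_inv, norm_norm, inv_mul_cancel₀ hf'.ne']) z
  rw [HInf.smul_apply, norm_mul, Complex.norm_real, norm_inv, norm_norm] at h
  rwa [inv_mul_le_iff₀ hf'] at h

theorem assocWeight_pos (v : Weight) (z : ℂ) : 0 < assocWeight v z := by
  refine (assocWeight_nonneg v z).lt_of_ne' fun h => ?_
  -- Test with the constant function `1`: as `0⁻¹ = 0`, a vanishing `ṽ` would force `1 ≤ 0`.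
  have := norm_apply_le_norm_mul_inv_assocWeight (HInf.monomial v 0) z
  rw [h, HInf.monomial_apply] at this
  norm_num at this

theorem assocWeight_mul_norm_le (f : HInf v) (z : ℂ) : assocWeight v z * ‖f z‖ ≤ ‖f‖ := by
  have h := norm_apply_le_norm_mul_inv_assocWeight f z
  rwa [← div_eq_mul_inv, le_div_iff₀ (assocWeight_pos v z), mul_comm] at h

theorem le_assocWeight (v : Weight) (z : ℂ) : v z ≤ assocWeight v z := by
  rw [← inv_le_inv₀ (assocWeight_pos v z) (v.radial_pos z)]
  refine inv_assocWeight_le fun f hf => ?_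
  refine (HInf.norm_apply_le f z).trans ?_
  rw [← one_div]
  have := (v.radial_pos z).le
  gcongr

/-- To compute the associated weight it suffices to consider functions in `H_v^0`. -/
theorem inv_assocWeight_le_of_HZero {z : ℂ} {C : ℝ}
    (h : ∀ f ∈ HZero v, ‖f‖ ≤ 1 → ‖f z‖ ≤ C) : (assocWeight v z)⁻¹ ≤ C := by
  refine inv_assocWeight_le fun f hf => ?_
  refine le_of_tendsto (HInf.tendsto_fejerCLM_apply f z).norm ?_
  filter_upwards [eventually_ne_atTop 0] with n hn
  exact h _ (fejerCLM_mem_HZero n f) ((HInf.norm_fejerCLM_apply_le hn f).trans hf)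

/-- One spare power suffices: `ṽ |z| ^ (k + 1)` is bounded by the norm of `z ^ (k + 1)`. -/
theorem tendsto_assocWeight_mul_norm_pow (v : Weight) (k : ℕ) :
    Tendsto (fun z : ℂ => assocWeight v z * ‖z ^ k‖) (cocompact ℂ) (𝓝 0) := by
  refine squeeze_zero' (.of_forall fun z => mul_nonneg (assocWeight_nonneg v z) (norm_nonneg _)) ?_
    ((tendsto_const_nhds (x := ‖HInf.monomial v (k + 1)‖)).div_atTop
      (tendsto_norm_cocompact_atTop (E := ℂ)))
  filter_upwards [tendsto_norm_cocompact_atTop.eventually_gt_atTop 0] with z hz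
  rw [le_div_iff₀ hz, mul_assoc, ← norm_mul, ← pow_succ, ← HInf.monomial_apply (v := v)]
  exact assocWeight_mul_norm_le _ z

/-- Holds for polynomials, and passes to norm limits because `ṽ|f| ≤ ‖f‖`. -/
theorem tendsto_assocWeight_mul_norm {f : HInf v} (hf : f ∈ HZero v) :
    Tendsto (fun z => assocWeight v z * ‖f z‖) (cocompact ℂ) (𝓝 0) := by
  refine HInf.tendsto_mul_norm_of_approx (assocWeight_nonneg v) assocWeight_mul_norm_le
    fun ε hε => ?_
  obtain ⟨n, hn⟩ := ((Metric.tendsto_nhds.1 (tendsto_fejerCLM_of_mem_HZero hf)) ε hε).exists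
  refine ⟨HInf.fejerCLM v n f, by rwa [norm_sub_rev, ← dist_eq_norm], ?_⟩
  simp only [HInf.fejerCLM_apply]
  exact tendsto_mul_norm_fejerMean (assocWeight_nonneg v) (tendsto_assocWeight_mul_norm_pow v) n f

end AssocWeight

/-! ### Weak compactness and weak cluster points -/

section WeakCompactness

variable {E F : Type*} [NormedAddCommGroup E] [NormedSpace ℂ E]
  [NormedAddCommGroup F] [NormedSpace ℂ F] {T : E →L[ℂ] F}

theorem isWeaklyCompactOperator_of_isCompactOperator (hT : IsCompactOperator T) :
    IsWeaklyCompactOperator T := by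
  have h1 : IsCompact (closure (T '' Metric.closedBall 0 1)) :=
    hT.isCompact_closure_image_closedBall (f := (T : E →ₗ[ℂ] F)) 1
  have h2 : IsCompact (toWeakSpace ℂ F '' closure (T '' Metric.closedBall 0 1)) :=
    h1.image (toWeakSpaceCLM ℂ F).continuous
  exact h2.of_isClosed_subset isClosed_closure
    (closure_minimal (Set.image_mono subset_closure) h2.isClosed)

theorem IsWeaklyCompactOperator.exists_mapClusterPt (hT : IsWeaklyCompactOperator T) {x : ℕ → E}
    (hx : ∀ n, ‖x n‖ ≤ 1) :
    ∃ y : F, MapClusterPt (toWeakSpace ℂ F y) atTop (fun n => toWeakSpace ℂ F (T (x n))) := by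
  have hK : IsCompact (closure (toWeakSpace ℂ F '' (T '' Metric.closedBall 0 1))) := hT
  have hle : map (fun n => toWeakSpace ℂ F (T (x n))) atTop ≤
      𝓟 (closure (toWeakSpace ℂ F '' (T '' Metric.closedBall 0 1))) := by
    refine tendsto_principal.2 (Eventually.of_forall fun n => subset_closure ?_)
    exact ⟨_, ⟨x n, mem_closedBall_zero_iff.2 (hx n), rfl⟩, rfl⟩
  obtain ⟨y, -, hy⟩ := hK hle
  exact ⟨(toWeakSpace ℂ F).symm y, hy⟩

theorem apply_eq_of_weak_mapClusterPt {y : F} {x : ℕ → F}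
    (h : MapClusterPt (toWeakSpace ℂ F y) atTop (fun n => toWeakSpace ℂ F (x n)))
    (φ : F →L[ℂ] ℂ) {a : ℂ} (ha : Tendsto (fun n => φ (x n)) atTop (𝓝 a)) : φ y = a := by
  have hφ : Continuous fun z : WeakSpace ℂ F => φ ((toWeakSpace ℂ F).symm z) :=
    WeakBilin.eval_continuous (topDualPairing ℂ F).flip φ
  have h1 := h.continuousAt_comp hφ.continuousAt
  have h2 : MapClusterPt (φ y) atTop fun n => φ (x n) := by simpa [Function.comp_def] using h1
  exact eq_of_nhds_neBot (h2.neBot.mono (inf_le_inf_left _ ha))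

/-- Mazur: a norm closed subspace is convex, hence weakly closed. -/
theorem mem_of_weak_mapClusterPt {y : F} {x : ℕ → F}
    (h : MapClusterPt (toWeakSpace ℂ F y) atTop (fun n => toWeakSpace ℂ F (x n)))
    {V : Submodule ℂ F} (hV : IsClosed (V : Set F)) (hx : ∀ n, x n ∈ V) : y ∈ V := by
  have h1 := Convex.toWeakSpace_closure ℂ (V.restrictScalars ℝ).convex
  have h2 : IsClosed (toWeakSpace ℂ F '' (V : Set F)) := by
    rw [← hV.closure_eq]
    exact h1 ▸ isClosed_closure
  obtain ⟨y', hy', hyy'⟩ := h2.mem_of_mapClusterPt h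
    (.of_forall fun n => Set.mem_image_of_mem _ (hx n))
  exact (toWeakSpace ℂ F).injective hyy' ▸ hy'

end WeakCompactness

/-! ### Compactness of multiplication operators -/

variable {w : Weight} {h : ℂ → ℂ}

/-- The multiplication operator `M_h` when `w |h|` is bounded by a multiple of `ṽ`. -/
noncomputable def mulCLM (hh : Differentiable ℂ h) (C : ℝ)
    (hC : ∀ z, w z * ‖h z‖ ≤ C * assocWeight v z) : HInf v →L[ℂ] HInf w :=
  have hle : ∀ (f : HInf v) z, w z * ‖h z * f z‖ ≤ C * ‖f‖ := fun f z => by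
    have hC0 : 0 ≤ C := nonneg_of_mul_nonneg_left
      ((mul_nonneg (w.radial_pos z).le (norm_nonneg _)).trans (hC z)) (assocWeight_pos v z)
    rw [norm_mul, ← mul_assoc]
    calc _ ≤ C * assocWeight v z * ‖f z‖ :=
          mul_le_mul_of_nonneg_right (hC z) (norm_nonneg _)
      _ = C * (assocWeight v z * ‖f z‖) := mul_assoc _ _ _
      _ ≤ _ := by gcongr; exact assocWeight_mul_norm_le f z
  LinearMap.mkContinuous
    { toFun := fun f => ⟨fun z => h z * f z, hh.mul f.2.1, C * ‖f‖, by
        rintro _ ⟨z, rfl⟩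
        exact hle f z⟩
      map_add' := fun f g => HInf.ext fun z => mul_add (h z) (f z) (g z)
      map_smul' := fun c f => HInf.ext fun z => mul_left_comm (h z) c (f z) }
    C fun f => HInf.norm_le_of_forall_le (hle f)

theorem isMulOp_mulCLM (hh : Differentiable ℂ h) (C : ℝ)
    (hC : ∀ z, w z * ‖h z‖ ≤ C * assocWeight v z) : IsMulOp h (mulCLM hh C hC) :=
  fun _ _ => rfl

theorem exists_bound_of_tendsto (hh : Differentiable ℂ h)
    (h3 : Tendsto (fun z : ℂ => w z * ‖h z‖ / assocWeight v z) (cocompact ℂ) (𝓝 0)) :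
    ∃ C, ∀ z, w z * ‖h z‖ ≤ C * assocWeight v z := by
  obtain ⟨K, hK, hKs⟩ := mem_cocompact.1 (h3.eventually_lt_const one_pos)
  -- Continuity of `ṽ` is not needed: on the compact set, `v ≤ ṽ` replaces it by the continuous `v`.
  have hc : Continuous fun z => w z * ‖h z‖ / v z :=
    (w.continuous_radial.mul hh.continuous.norm).div v.continuous_radial
      fun z => (v.radial_pos z).ne'
  obtain ⟨C, hC⟩ := hK.bddAbove_image hc.continuousOn
  refine ⟨max C 1, fun z => (div_le_iff₀ (assocWeight_pos v z)).1 ?_⟩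
  by_cases hz : z ∈ K
  · refine le_max_of_le_left (le_trans ?_ (hC ⟨z, hz, rfl⟩))
    exact div_le_div_of_nonneg_left (mul_nonneg (w.radial_pos z).le (norm_nonneg _))
      (v.radial_pos z) (le_assocWeight v z)
  · exact le_max_of_le_right (le_of_lt (hKs hz))

/-- The decay condition makes `M_h` a norm limit of the finite rank operators `M_h ∘ S_n`, where
`S_n` are the Fejér mean operators. -/
theorem isCompactOperator_of_tendsto_div_assocWeight {T : HInf v →L[ℂ] HInf w}
    (hh : Differentiable ℂ h) (hT : IsMulOp h T)
    (h3 : Tendsto (fun z : ℂ => w z * ‖h z‖ / assocWeight v z) (cocompact ℂ) (𝓝 0)) :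
    IsCompactOperator T := by
  refine isCompactOperator_of_tendsto (l := atTop) (F := fun n => T.comp (HInf.fejerCLM v n)) ?_
    (.of_forall fun n => (HInf.isCompactOperator_fejerCLM n).clm_comp T)
  rw [tendsto_iff_norm_sub_tendsto_zero, Metric.tendsto_nhds]
  intro ε hε
  -- The factor `1/4` absorbs `‖S_n f - f‖ ≤ 2‖f‖` outside the disc, leaving `ε / 2`.
  obtain ⟨R, hR, hwR⟩ : ∃ R > 0, ∀ z : ℂ, R ≤ ‖z‖ → w z * ‖h z‖ / assocWeight v z < ε / 4 := by
    have h1 := h3.eventually_lt_const (show 0 < ε / 4 by positivity)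
    rw [← Metric.cobounded_eq_cocompact, ← comap_norm_atTop] at h1
    obtain ⟨R, hR⟩ := eventually_atTop.1 (eventually_comap.1 h1)
    exact ⟨max R 1, by positivity, fun z hz => hR ‖z‖ ((le_max_left _ _).trans hz) z rfl⟩
  obtain ⟨K, hK⟩ := (isCompact_closedBall (0 : ℂ) R).bddAbove_image
    (w.continuous_radial.mul hh.continuous.norm).continuousOn
  have hK' : ∀ z, ‖z‖ ≤ R → w z * ‖h z‖ ≤ K := fun z hz => hK ⟨z, by simpa using hz, rfl⟩
  have hK0 : 0 ≤ K := (mul_nonneg (w.radial_pos 0).le (norm_nonneg _)).trans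
    (hK' 0 (by simpa using hR.le))
  have h2 := (tendsto_const_div_atTop_nhds_zero_nat (2 * (v (2 * R : ℝ))⁻¹)).const_mul K
  rw [mul_zero] at h2
  filter_upwards [h2.eventually_lt_const (half_pos hε), eventually_ne_atTop 0] with n hn hn0
  rw [Real.dist_0_eq_abs, abs_of_nonneg (norm_nonneg _)]
  refine lt_of_le_of_lt ?_ (half_lt_self hε)
  refine ContinuousLinearMap.opNorm_le_bound _ (half_pos hε).le fun f => ?_
  refine HInf.norm_le_of_forall_le fun z => ?_
  have heq : (T.comp (HInf.fejerCLM v n) - T) f z = h z * (HInf.fejerCLM v n f - f) z := by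
    change T (HInf.fejerCLM v n f) z - T f z = _
    rw [hT, hT, HInf.sub_apply, mul_sub]
  rw [heq, norm_mul, ← mul_assoc]
  rcases le_total ‖z‖ R with hz | hz
  · calc _ ≤ K * (2 * (‖f‖ / v (2 * R : ℝ)) / n) :=
          mul_le_mul (hK' z hz) (HInf.norm_fejerCLM_apply_sub_le hn0 f hR hz) (norm_nonneg _) hK0
      _ = K * (2 * (v (2 * R : ℝ))⁻¹ / n) * ‖f‖ := by ring
      _ ≤ _ := by gcongr
  · have h4 := (div_lt_iff₀ (assocWeight_pos v z)).1 (hwR z hz)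
    have h5 : ‖HInf.fejerCLM v n f - f‖ ≤ 2 * ‖f‖ := by
      have := norm_sub_le (HInf.fejerCLM v n f) f
      have := HInf.norm_fejerCLM_apply_le hn0 f
      linarith
    calc _ ≤ ε / 4 * assocWeight v z * ‖(HInf.fejerCLM v n f - f) z‖ := by gcongr
      _ = ε / 4 * (assocWeight v z * ‖(HInf.fejerCLM v n f - f) z‖) := mul_assoc _ _ _
      _ ≤ ε / 4 * (2 * ‖f‖) :=
          mul_le_mul_of_nonneg_left ((assocWeight_mul_norm_le _ z).trans h5) (by positivity)
      _ = _ := by ring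

/-- At fixed `z`, every `f` in the unit ball has `w|h||f| ≤ ‖T‖`; the supremum of `|f(z)|` is
`1/ṽ(z)`. -/
theorem IsMulOp.le_norm_mul_assocWeight {T : HInf v →L[ℂ] HInf w} (hT : IsMulOp h T) (z : ℂ) :
    w z * ‖h z‖ ≤ ‖T‖ * assocWeight v z := by
  rw [← div_le_iff₀ (assocWeight_pos v z)]
  rcases (mul_nonneg (w.radial_pos z).le (norm_nonneg (h z))).eq_or_lt with h0 | h0
  · rw [← h0, zero_div]
    exact norm_nonneg T
  rw [div_eq_mul_inv, ← le_div_iff₀' h0]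
  refine inv_assocWeight_le fun f hf => ?_
  rw [le_div_iff₀' h0, mul_assoc, ← norm_mul, ← hT f z]
  exact (HInf.le_norm (T f) z).trans (T.unit_le_opNorm f hf)

theorem IsMulOp.apply_mem_HZero {T : HInf v →L[ℂ] HInf w} (hT : IsMulOp h T) {f : HInf v}
    (hf : f ∈ HZero v) : T f ∈ HZero w := by
  refine ⟨(T f).2.1, ?_⟩
  have h1 := (tendsto_assocWeight_mul_norm hf).const_mul ‖T‖
  rw [mul_zero] at h1
  refine squeeze_zero (fun z => mul_nonneg (w.radial_pos z).le (norm_nonneg _)) (fun z => ?_) h1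
  rw [hT f z, norm_mul, ← mul_assoc, ← mul_assoc]
  exact mul_le_mul_of_nonneg_right (hT.le_norm_mul_assocWeight z) (norm_nonneg _)

theorem exists_isMulOpZero_isCompactOperator {T : HInf v →L[ℂ] HInf w} (hT : IsMulOp h T)
    (hTc : IsCompactOperator T) :
    ∃ T : HZero v →L[ℂ] HZero w, IsMulOpZero h T ∧ IsCompactOperator T :=
  ⟨(T.comp (HZero v).subtypeL).codRestrict (HZero w) fun f => hT.apply_mem_HZero f.2,
    fun f z => hT f z,
    (hTc.comp_clm (HZero v).subtypeL).codRestrict (fun f => hT.apply_mem_HZero f.2)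
      (isClosed_HZero w)⟩

/-- On a totally bounded subset of `H_w^0`, functions decay uniformly against `w̃`. -/
theorem eventually_forall_assocWeight_mul_norm_lt {A : Set (HZero w)} (hA : TotallyBounded A)
    {ε : ℝ} (hε : 0 < ε) :
    ∀ᶠ z in cocompact ℂ, ∀ g ∈ A, assocWeight w z * ‖(g : HInf w) z‖ < ε := by
  obtain ⟨t, ht, hAt⟩ := Metric.totallyBounded_iff.1 hA (ε / 2) (half_pos hε)
  have h1 : ∀ᶠ z in cocompact ℂ, ∀ g ∈ t, assocWeight w z * ‖(g : HInf w) z‖ < ε / 2 :=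
    (eventually_all_finite ht).2 fun g _ =>
      (tendsto_assocWeight_mul_norm g.2).eventually_lt_const (half_pos hε)
  filter_upwards [h1] with z hz g hg
  obtain ⟨g', hg', hgg'⟩ := Set.mem_iUnion₂.1 (hAt hg)
  rw [Metric.mem_ball, dist_eq_norm] at hgg'
  have h2 := assocWeight_mul_norm_le ((g : HInf w) - (g' : HInf w)) z
  have h3 : ‖(g : HInf w) - (g' : HInf w)‖ < ε / 2 := hgg'
  have h4 : ‖(g : HInf w) z‖ ≤ ‖((g : HInf w) - (g' : HInf w)) z‖ + ‖(g' : HInf w) z‖ := by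
    rw [HInf.sub_apply]
    simpa using norm_add_le ((g : HInf w) z - (g' : HInf w) z) ((g' : HInf w) z)
  have h5 := mul_le_mul_of_nonneg_left h4 (assocWeight_nonneg w z)
  have h6 := hz g' hg'
  linarith

/-- The image of the unit ball decays uniformly against `w̃`, and the supremum of `|f(z)|` over the
unit ball of `H_v^0` is still `1/ṽ(z)`. -/
theorem tendsto_of_isMulOpZero_of_isCompactOperator {T : HZero v →L[ℂ] HZero w}
    (hT : IsMulOpZero h T) (hTc : IsCompactOperator T) :
    Tendsto (fun z : ℂ => assocWeight w z * ‖h z‖ / assocWeight v z) (cocompact ℂ) (𝓝 0) := by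
  have hK : IsCompact (closure (T '' Metric.closedBall 0 1)) :=
    hTc.isCompact_closure_image_closedBall (f := (T : HZero v →ₗ[ℂ] HZero w)) 1
  rw [Metric.tendsto_nhds]
  intro ε hε
  filter_upwards [eventually_forall_assocWeight_mul_norm_lt
    (hK.totallyBounded.subset subset_closure) (half_pos hε)] with z hz
  have h0 : 0 ≤ assocWeight w z * ‖h z‖ := mul_nonneg (assocWeight_nonneg w z) (norm_nonneg _)
  rw [Real.dist_0_eq_abs, abs_of_nonneg (div_nonneg h0 (assocWeight_nonneg v z))]
  refine lt_of_le_of_lt ?_ (half_lt_self hε)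
  rcases h0.eq_or_lt with h0 | h0
  · rw [← h0, zero_div]
    exact (half_pos hε).le
  rw [div_eq_mul_inv, ← le_div_iff₀' h0]
  refine inv_assocWeight_le_of_HZero fun f hf hf1 => ?_
  rw [le_div_iff₀' h0, mul_assoc, ← norm_mul, ← hT ⟨f, hf⟩ z]
  exact (hz _ ⟨⟨f, hf⟩, mem_closedBall_zero_iff.2 hf1, rfl⟩).le

theorem tendsto_of_tendsto_assocWeight
    (h4 : Tendsto (fun z : ℂ => assocWeight w z * ‖h z‖ / assocWeight v z) (cocompact ℂ) (𝓝 0)) :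
    Tendsto (fun z : ℂ => w z * ‖h z‖ / assocWeight v z) (cocompact ℂ) (𝓝 0) := by
  refine squeeze_zero (fun z => ?_) (fun z => ?_) h4
  · exact div_nonneg (mul_nonneg (w.radial_pos z).le (norm_nonneg _)) (assocWeight_nonneg v z)
  · have := assocWeight_nonneg v z
    gcongr
    exact le_assocWeight w z

/-! ### From weak compactness to decay, via interpolation -/

theorem forall_tendsto_of_unitBall
    (hf : ∀ f : HInf v, ‖f‖ ≤ 1 → Tendsto (fun z => w z * ‖h z * f z‖) (cocompact ℂ) (𝓝 0))
    (f : HInf v) : Tendsto (fun z => w z * ‖h z * f z‖) (cocompact ℂ) (𝓝 0) := by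
  have hpos : 0 < ‖f‖ + 1 := by positivity
  have h1 := (hf ((((‖f‖ + 1)⁻¹ : ℝ) : ℂ) • f) (by
    rw [norm_smul, Complex.norm_real, norm_inv, Real.norm_of_nonneg hpos.le,
      inv_mul_le_iff₀ hpos]
    linarith)).const_mul (‖f‖ + 1)
  rw [mul_zero] at h1
  refine h1.congr fun z => ?_
  rw [HInf.smul_apply, norm_mul, norm_mul, norm_mul, Complex.norm_real, norm_inv,
    Real.norm_of_nonneg hpos.le]
  field_simp

/-- The functions `T(S_n f)` lie in the weakly closed `H_w^0`, so a weak cluster point does too;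
evaluating it at each `z` shows that it is `hf`. -/
theorem tendsto_of_isMulOp_of_isWeaklyCompactOperator {T : HInf v →L[ℂ] HInf w}
    (hT : IsMulOp h T) (hTw : IsWeaklyCompactOperator T) (f : HInf v) :
    Tendsto (fun z => w z * ‖h z * f z‖) (cocompact ℂ) (𝓝 0) := by
  refine forall_tendsto_of_unitBall (fun f hf => ?_) f
  -- The shift to `n + 1` meets the condition `n ≠ 0` in the contraction bound.
  obtain ⟨y, hy⟩ := hTw.exists_mapClusterPt (x := fun n => HInf.fejerCLM v (n + 1) f)
    fun n => (HInf.norm_fejerCLM_apply_le n.succ_ne_zero f).trans hf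
  have h1 : y ∈ HZero w := mem_of_weak_mapClusterPt hy (isClosed_HZero w)
    fun n => hT.apply_mem_HZero (fejerCLM_mem_HZero (n + 1) f)
  refine h1.2.congr fun z => ?_
  rw [← HInf.evalCLM_apply, apply_eq_of_weak_mapClusterPt hy (HInf.evalCLM w z)]
  simp only [HInf.evalCLM_apply]
  exact (((tendsto_add_atTop_iff_nat 1).2 (HInf.tendsto_fejerCLM_apply f z)).const_mul
    (h z)).congr fun n => (hT _ z).symm

/-- Although `f` need not lie in `H_v^0`, its Fejér means do; the cluster point is in `H_w^0` by
type. -/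
theorem tendsto_of_isMulOpZero_of_isWeaklyCompactOperator {T : HZero v →L[ℂ] HZero w}
    (hT : IsMulOpZero h T) (hTw : IsWeaklyCompactOperator T) (f : HInf v) :
    Tendsto (fun z => w z * ‖h z * f z‖) (cocompact ℂ) (𝓝 0) := by
  refine forall_tendsto_of_unitBall (fun f hf => ?_) f
  obtain ⟨y, hy⟩ := hTw.exists_mapClusterPt
    (x := fun n => ⟨HInf.fejerCLM v (n + 1) f, fejerCLM_mem_HZero (n + 1) f⟩)
    fun n => (HInf.norm_fejerCLM_apply_le n.succ_ne_zero f).trans hf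
  refine y.2.2.congr fun z => ?_
  have h1 := apply_eq_of_weak_mapClusterPt hy ((HInf.evalCLM w z).comp (HZero w).subtypeL)
    (a := h z * f z)
    ((((tendsto_add_atTop_iff_nat 1).2 (HInf.tendsto_fejerCLM_apply f z)).const_mul
      (h z)).congr fun n => (hT _ z).symm)
  rw [← h1]
  rfl

/-- If `M_h` maps `H_v^∞` into `H_w^0` and there are enough interpolating sequences, then testing on
functions with `f(z_j) = 1 / ṽ(z_j)` gives the decay condition. -/
theorem tendsto_of_hasInterpolatingSubseqs (hi : HasInterpolatingSubseqs (assocWeight v))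
    (hf : ∀ f : HInf v, Tendsto (fun z => w z * ‖h z * f z‖) (cocompact ℂ) (𝓝 0)) :
    Tendsto (fun z : ℂ => w z * ‖h z‖ / assocWeight v z) (cocompact ℂ) (𝓝 0) := by
  by_contra hcon
  obtain ⟨ε, hε, hfreq⟩ : ∃ ε > 0, ∃ᶠ z in cocompact ℂ,
      ε ≤ w z * ‖h z‖ / assocWeight v z := by
    rw [Metric.tendsto_nhds] at hcon
    push Not at hcon
    obtain ⟨ε, hε, hcon⟩ := hcon
    refine ⟨ε, hε, hcon.mono fun z hz => ?_⟩
    rwa [Real.dist_0_eq_abs, abs_of_nonneg (div_nonneg (mul_nonneg (w.radial_pos z).le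
      (norm_nonneg _)) (assocWeight_nonneg v z))] at hz
  have : (cocompact ℂ).IsCountablyGenerated := by
    rw [← Metric.cobounded_eq_cocompact, ← comap_norm_atTop]
    infer_instance
  obtain ⟨z, hz, hzε⟩ := exists_seq_forall_of_frequently hfreq
  -- Strictly increasing moduli make the points distinct, as discreteness demands.
  obtain ⟨φ, hφ, hzφ⟩ := strictMono_subseq_of_tendsto_atTop
    ((tendsto_norm_cocompact_atTop (E := ℂ)).comp hz)
  have hinj : Function.Injective (z ∘ φ) := fun a b hab =>
    hzφ.injective (congrArg norm hab)
  obtain ⟨ψ, hψ, hint⟩ := hi (z ∘ φ) ⟨hinj, hz.comp hφ.tendsto_atTop⟩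
  set ζ : ℕ → ℂ := (z ∘ φ) ∘ ψ
  have hζ : Tendsto ζ atTop (cocompact ℂ) :=
    (hz.comp hφ.tendsto_atTop).comp hψ.tendsto_atTop
  obtain ⟨f, ⟨hfd, B, hB⟩, hfζ⟩ := hint
    (fun j => (((assocWeight v (ζ j))⁻¹ : ℝ) : ℂ)) ⟨1, by
      rintro _ ⟨j, rfl⟩
      have := assocWeight_pos v (ζ j)
      simp only [Complex.norm_real, norm_inv, Real.norm_of_nonneg this.le]
      rw [mul_inv_cancel₀ this.ne']⟩
  -- The interpolant lies in `H_v^∞` because `v ≤ ṽ`.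
  have hmem : MemHInf v f := ⟨hfd, B, by
    rintro _ ⟨x, rfl⟩
    exact (mul_le_mul_of_nonneg_right (le_assocWeight v x) (norm_nonneg _)).trans (hB ⟨x, rfl⟩)⟩
  have h1 := ((hf ⟨f, hmem⟩).comp hζ).eventually_lt_const hε
  obtain ⟨j, hj⟩ := h1.exists
  have h2 := hzε (φ (ψ j))
  have h3 : w (ζ j) * ‖h (ζ j) * f (ζ j)‖ < ε := hj
  rw [hfζ, norm_mul, Complex.norm_real, norm_inv, Real.norm_of_nonneg (assocWeight_nonneg v _),
    ← mul_assoc, ← div_eq_mul_inv] at h3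
  exact absurd h2 (not_le.2 h3)

end WeightedEntire

/-! ### The equivalences -/

theorem proposition2p2 (v w : Weight) (h : ℂ → ℂ) (hh : Differentiable ℂ h) :
    List.TFAE [
      ∃ T : HInf v →L[ℂ] HInf w, IsMulOp h T ∧ IsCompactOperator T,
      ∃ T : HZero v →L[ℂ] HZero w, IsMulOpZero h T ∧ IsCompactOperator T,
      Tendsto (fun z : ℂ => w z * ‖h z‖ / assocWeight v z) (cocompact ℂ) (𝓝 0),
      Tendsto (fun z : ℂ => assocWeight w z * ‖h z‖ / assocWeight v z) (cocompact ℂ) (𝓝 0)] ∧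
    (HasInterpolatingSubseqs (assocWeight v) →
      List.TFAE [
        ∃ T : HInf v →L[ℂ] HInf w, IsMulOp h T ∧ IsCompactOperator T,
        ∃ T : HZero v →L[ℂ] HZero w, IsMulOpZero h T ∧ IsCompactOperator T,
        Tendsto (fun z : ℂ => w z * ‖h z‖ / assocWeight v z) (cocompact ℂ) (𝓝 0),
        Tendsto (fun z : ℂ => assocWeight w z * ‖h z‖ / assocWeight v z) (cocompact ℂ) (𝓝 0),
        ∃ T : HInf v →L[ℂ] HInf w, IsMulOp h T ∧ IsWeaklyCompactOperator T,
        ∃ T : HZero v →L[ℂ] HZero w, IsMulOpZero h T ∧ IsWeaklyCompactOperator T]) := by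
  have h12 : (∃ T : HInf v →L[ℂ] HInf w, IsMulOp h T ∧ IsCompactOperator T) →
      ∃ T : HZero v →L[ℂ] HZero w, IsMulOpZero h T ∧ IsCompactOperator T :=
    fun ⟨_, hT, hTc⟩ => exists_isMulOpZero_isCompactOperator hT hTc
  have h24 : (∃ T : HZero v →L[ℂ] HZero w, IsMulOpZero h T ∧ IsCompactOperator T) →
      Tendsto (fun z : ℂ => assocWeight w z * ‖h z‖ / assocWeight v z) (cocompact ℂ) (𝓝 0) :=
    fun ⟨_, hT, hTc⟩ => tendsto_of_isMulOpZero_of_isCompactOperator hT hTc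
  have h43 := tendsto_of_tendsto_assocWeight (v := v) (w := w) (h := h)
  have h31 : Tendsto (fun z : ℂ => w z * ‖h z‖ / assocWeight v z) (cocompact ℂ) (𝓝 0) →
      ∃ T : HInf v →L[ℂ] HInf w, IsMulOp h T ∧ IsCompactOperator T := fun h3 =>
    let ⟨C, hC⟩ := exists_bound_of_tendsto hh h3
    ⟨mulCLM hh C hC, isMulOp_mulCLM hh C hC,
      isCompactOperator_of_tendsto_div_assocWeight hh (isMulOp_mulCLM hh C hC) h3⟩
  refine ⟨?_, fun hi => ?_⟩
  · tfae_have 1 → 2 := h12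
    tfae_have 2 → 4 := h24
    tfae_have 4 → 3 := h43
    tfae_have 3 → 1 := h31
    tfae_finish
  · tfae_have 1 → 2 := h12
    tfae_have 2 → 4 := h24
    tfae_have 4 → 3 := h43
    tfae_have 3 → 1 := h31
    tfae_have 1 → 5 := fun ⟨T, hT, hTc⟩ => ⟨T, hT, isWeaklyCompactOperator_of_isCompactOperator hTc⟩
    tfae_have 2 → 6 := fun ⟨T, hT, hTc⟩ => ⟨T, hT, isWeaklyCompactOperator_of_isCompactOperator hTc⟩
    tfae_have 5 → 3 := fun ⟨_, hT, hTw⟩ => tendsto_of_hasInterpolatingSubseqs hi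
      (tendsto_of_isMulOp_of_isWeaklyCompactOperator hT hTw)
    tfae_have 6 → 3 := fun ⟨_, hT, hTw⟩ => tendsto_of_hasInterpolatingSubseqs hi
      (tendsto_of_isMulOpZero_of_isWeaklyCompactOperator hT hTw)
    tfae_finish
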